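/- Let $X$ be a complex with finitely many cells in each dimension: finite sets $X_n$ ($n\ge 0$) of $n$-cells and integer matrices $\partial_n\colon C_n=\mathbb{Z}^{X_n}\to C_{n-1}=\mathbb{Z}^{X_{n-1}}$ ($n\ge 1$), augmented by $C_{-1}=\mathbb{Z}$ and $\partial_0(x)=1$ for every $x\in X_0$, with $\partial_{n-1}\partial_n=0$ for all $n\ge 1$ (for example, a finite cell complex with its cellular boundary maps); put $C_n=0$ for $n<-1$. Let $Z_n=\ker\partial_n$, $B_n=\operatorname{im}\partial_{n+1}$, $\widetilde H_n(X)=Z_n/B_n$, $\delta_n=\partial_{n+1}^t$ and $Z^n=\ker\delta_n$, all over $\mathbb{Z}$. Fix $i\ge 0$ and assume the unicycle condition $$\operatorname{rk}\widetilde H_{i+1}(X)=0,\qquad \operatorname{rk}\widetilde H_i(X)=1,\qquad \operatorname{rk}\widetilde H_{i-1}(X)=0 .$$ For $I\subseteq X_i$ let $X_I$ be the subcomplex consisting of $I$ and all cells of dimension less than $i$. * The $i$-tree number is $k_i(X)=\sum_T|\widetilde H_{i-1}(T)|^2$, where $T=X_I$ runs over the $i$-dimensional spanning trees, i.e. those $I$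 for which the columns of $\partial_i$ indexed by $I$ form a $\mathbb{Q}$-basis of the column space of $\partial_i$. * The dual tree number is $k^i(X)=\det\big([\delta_i]_D[\delta_i]_D^t\big)$, where $[\delta_i]_D$ is the matrix of $\delta_i\colon C_i\to Z^{i+1}$ with respect to the standard basis of $C_i$ and a $\mathbb{Z}$-basis $D$ of $Z^{i+1}$. * An $i$-dimensional cycletree is a subcomplex $U=X_I$ with $|I|=n+1$, where $n=\operatorname{rk}Z_{i-1}$. Fix a $\mathbb{Z}$-basis $Z$ of $Z_{i-1}$ and a linear order on $X_i$, let $I=\{x_1<\dots<x_{n+1}\}$, and let $A$ be the $n\times(n+1)$ matrix whose $j$-th column is the coordinate vector of $\partial_i x_j$ with respect to $Z$. The cycle part of $U$ is $C_U=\sum_{j}(-1)^j\det([A]_j)\,x_j\in Z_i$, where $[A]_j$ is $A$ without its $j$-th column. * Fix a $\mathbb{Z}$-basis $W$ of $Z_i$ and a $\mathbb{Z}$-basis $b_1,\dots,b_m$ of $B_i$ (so that $\operatorname{rk}Z_i=m+1$). The winding number of $z\in Z_i$ is $w(z)=\det\big([z]_W,[b_1]_W,\dots,[b_m]_W\big)$,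 where $[\,\cdot\,]_W$ denotes the coordinate column with respect to $W$. * The standard harmonic cycle is $\lambda=\sum_U w(C_U)\,C_U\in Z_i$, the sum being over all $i$-dimensional cycletrees $U$. Then, for every choice of the bases and of the order, and with $\circ$ the standard inner product on $C_i$ for which $X_i$ is orthonormal, $$\lambda\circ\lambda=k^i(X)\,k_i(X)\,|\widetilde H_{i-1}(X)|^2 .$$ -/

import Mathlib

universe u

/-- A complex with finitely many cells in each dimension, given by its sets of `n`-cells and the
integer incidence matrices of its boundary maps, together with the augmentation: there is exactly
one cell of dimension `-1` (the empty cell), none of dimension below `-1`, and `∂₀` is the all-ones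
row. `bd m n` is the matrix of `∂ₙ : Cₙ → Cₘ` when `m + 1 = n`, and is zero otherwise. A complex of
dimension `d` is one with no cells above dimension `d`. -/
structure CellComplex where
  cells : ℤ → Type u
  [fintypeCells : ∀ n, Fintype (cells n)]
  bd : ∀ m n : ℤ, Matrix (cells m) (cells n) ℤ
  bd_eq_zero : ∀ m n : ℤ, m + 1 ≠ n → bd m n = 0
  bd_mul_bd : ∀ l m n : ℤ, bd l m * bd m n = 0
  isEmpty_cells : ∀ n : ℤ, n < -1 → IsEmpty (cells n)
  emptyCell : cells (-1)
  eq_emptyCell : ∀ x : cells (-1), x = emptyCell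
  bd_zero : ∀ v : cells 0, bd (-1) 0 emptyCell v = 1

attribute [instance] CellComplex.fintypeCells

noncomputable section

namespace CellComplex

variable (X : CellComplex.{u})

/-- `Zₙ(X) = ker ∂ₙ` in the augmented chain complex. -/
def cycles (n : ℤ) : Submodule ℤ (X.cells n → ℤ) :=
  LinearMap.ker (X.bd (n - 1) n).mulVecLin

/-- `Bₙ(X) = im ∂ₙ₊₁`. -/
def boundaries (n : ℤ) : Submodule ℤ (X.cells n → ℤ) :=
  LinearMap.range (X.bd n (n + 1)).mulVecLin

/-- `Zⁿ(X) = ker δₙ`, where `δₙ = ∂ₙ₊₁ᵗ`. -/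
def cocycles (n : ℤ) : Submodule ℤ (X.cells n → ℤ) :=
  LinearMap.ker (X.bd n (n + 1)).transpose.mulVecLin

/-- The reduced homology group `H̃ₙ(X) = Zₙ(X) / Bₙ(X)` with integer coefficients. -/
abbrev RedHomology (n : ℤ) : Type u :=
  X.cycles n ⧸ (X.boundaries n).submoduleOf (X.cycles n)

/-- A subcomplex: a set of cells containing every cell that occurs in the boundary of one of its
cells. -/
structure Subcomplex where
  carrier : ∀ n : ℤ, Set (X.cells n)
  closed : ∀ (m n : ℤ) (x : X.cells n), x ∈ carrier n →
    ∀ y : X.cells m, X.bd m n y x ≠ 0 → y ∈ carrier m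

variable {X}

namespace Subcomplex

/-- `Cₙ(Y)`: the chains supported on the cells of `Y`. -/
def chains (Y : X.Subcomplex) (n : ℤ) : Submodule ℤ (X.cells n → ℤ) where
  carrier := {c | ∀ x, x ∉ Y.carrier n → c x = 0}
  add_mem' := fun {a b} ha hb x hx => by simp [ha x hx, hb x hx]
  zero_mem' := fun _ _ => rfl
  smul_mem' := fun r a ha x hx => by simp [ha x hx]

/-- `Zₙ(Y)`. -/
def cycles (Y : X.Subcomplex) (n : ℤ) : Submodule ℤ (X.cells n → ℤ) :=
  X.cycles n ⊓ Y.chains n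

/-- `Bₙ(Y) = ∂ₙ₊₁(Cₙ₊₁(Y))`. -/
def boundaries (Y : X.Subcomplex) (n : ℤ) : Submodule ℤ (X.cells n → ℤ) :=
  (Y.chains (n + 1)).map (X.bd n (n + 1)).mulVecLin

/-- The reduced homology group `H̃ₙ(Y)`. -/
abbrev RedHomology (Y : X.Subcomplex) (n : ℤ) : Type u :=
  Y.cycles n ⧸ (Y.boundaries n).submoduleOf (Y.cycles n)

end Subcomplex

/-- The subcomplex `Xⁱ⁻¹ ∪ I`, for a set `I` of `i`-cells. -/
def spanningSubcomplex {i : ℤ} (I : Finset (X.cells i)) : X.Subcomplex where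
  carrier := fun n => {x | n < i ∨ ∃ h : n = i, h ▸ x ∈ I}
  closed := by
    intro m n x hx y hy
    have hmn : m + 1 = n := by
      by_contra h
      exact hy (by simp [X.bd_eq_zero m n h])
    left
    rcases hx with hx | ⟨hx, _⟩ <;> omega

/-- The column of `∂ₙ` indexed by the `n`-cell `x`, with rational entries. -/
def ratColumn {n : ℤ} (x : X.cells n) : X.cells (n - 1) → ℚ :=
  fun y => (X.bd (n - 1) n y x : ℚ)

/-- `Xⁱ⁻¹ ∪ I` is an `i`-dimensional spanning tree: the columns of `∂ᵢ` indexed by `I` form a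
`ℚ`-basis of the column space of `∂ᵢ`. -/
def IsSpanningTree {i : ℤ} (I : Finset (X.cells i)) : Prop :=
  LinearIndepOn ℚ (ratColumn (X := X) (n := i)) (I : Set (X.cells i)) ∧
    Submodule.span ℚ (ratColumn (X := X) (n := i) '' (I : Set (X.cells i))) =
      Submodule.span ℚ (Set.range (ratColumn (X := X) (n := i)))

variable (X)

open Classical in
/-- The `i`-tree number `kᵢ(X) = ∑_T |H̃ᵢ₋₁(T)|²`, over all `i`-dimensional spanning trees `T`. -/
def treeNumber (i : ℤ) : ℕ :=
  ∑ I : Finset (X.cells i) with IsSpanningTree I,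
    Nat.card ((spanningSubcomplex I).RedHomology (i - 1)) ^ 2

/-- `rk Zₙ(X)`. -/
abbrev cycleRank (n : ℤ) : ℕ := Module.finrank ℤ (X.cycles n)

/-- The `i`-dimensional cycletrees `U = Xⁱ⁻¹ ∪ I(U)`, given by the set `I(U)` of their `i`-cells,
which has `rk Zᵢ₋₁(X) + 1` elements. -/
abbrev Cycletree (i : ℤ) : Type u :=
  {I : Finset (X.cells i) // I.card = X.cycleRank (i - 1) + 1}

variable {X}

/-- The column `∂ᵢ(x)` of `∂ᵢ`, as an element of `Zᵢ₋₁(X)`. -/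
def boundaryColumn {i : ℤ} (x : X.cells i) : X.cycles (i - 1) :=
  ⟨fun y => X.bd (i - 1) i y x, by
    rw [cycles, LinearMap.mem_ker]
    ext y
    exact congrFun (congrFun (X.bd_mul_bd (i - 1 - 1) (i - 1) i) y) x⟩

/-- The column `δᵢ(x)` of `δᵢ = ∂ᵢ₊₁ᵗ`, as an element of `Zⁱ⁺¹(X)`. -/
def coboundaryColumn {i : ℤ} (x : X.cells i) : X.cocycles (i + 1) :=
  ⟨fun y => X.bd i (i + 1) x y, by
    rw [cocycles, LinearMap.mem_ker]
    ext y
    have h := congrFun (congrFun (X.bd_mul_bd i (i + 1) (i + 1 + 1)) x) y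
    rw [Matrix.mulVecLin_apply, Matrix.mulVec_transpose]
    exact h⟩

/-- The matrix `[∂ᵢ]_Z` of `∂ᵢ : Cᵢ(X) → Zᵢ₋₁(X)` with respect to a basis `Z` of `Zᵢ₋₁(X)`. -/
def boundaryMatrix {i : ℤ} {r : ℕ} (Z : Module.Basis (Fin r) ℤ (X.cycles (i - 1))) :
    Matrix (Fin r) (X.cells i) ℤ :=
  Matrix.of fun a x => Z.repr (boundaryColumn x) a

/-- The matrix `[δᵢ]_Z` of `δᵢ : Cᵢ(X) → Zⁱ⁺¹(X)` with respect to a basis `Z` of `Zⁱ⁺¹(X)`. -/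
def coboundaryMatrix {i : ℤ} {k : ℕ} (Z : Module.Basis (Fin k) ℤ (X.cocycles (i + 1))) :
    Matrix (Fin k) (X.cells i) ℤ :=
  Matrix.of fun a x => Z.repr (coboundaryColumn x) a

/-- The `i`-th dual tree number `kⁱ(X) = det([δᵢ]_Z [δᵢ]_Zᵗ)`, computed with a basis `Z` of
`Zⁱ⁺¹(X)`. -/
def dualTreeNumber {i : ℤ} {k : ℕ} (Z : Module.Basis (Fin k) ℤ (X.cocycles (i + 1))) : ℤ :=
  (coboundaryMatrix Z * (coboundaryMatrix Z).transpose).det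

/-- For an `n × (n+1)` matrix `A`, the vector whose `j`-th entry (counted from `1`) is `(-1)ʲ`
times the determinant of `A` without its `j`-th column. -/
def minorVector {n : ℕ} (A : Matrix (Fin n) (Fin (n + 1)) ℤ) : Fin (n + 1) → ℤ :=
  fun j => (-1) ^ ((j : ℕ) + 1) * (A.submatrix id j.succAbove).det

theorem mulVec_minorVector {n : ℕ} (A : Matrix (Fin n) (Fin (n + 1)) ℤ) :
    A.mulVec (minorVector A) = 0 := by
  ext a
  let M : Matrix (Fin (n + 1)) (Fin (n + 1)) ℤ := Matrix.of (Fin.cons (A a) A)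
  have h0 : M.det = 0 := by
    apply Matrix.det_zero_of_row_eq (i := 0) (j := a.succ) (Fin.succ_ne_zero a).symm
    rfl
  rw [Matrix.det_succ_row_zero] at h0
  have hs : ∀ j : Fin (n + 1), M.submatrix Fin.succ j.succAbove = A.submatrix id j.succAbove := by
    intro j
    rfl
  simp only [hs] at h0
  have : A.mulVec (minorVector A) a =
      -∑ j : Fin (n + 1), (-1) ^ (j : ℕ) * M 0 j * (A.submatrix id j.succAbove).det := by
    rw [Matrix.mulVec, dotProduct, ← Finset.sum_neg_distrib]
    refine Finset.sum_congr rfl fun j _ => ?_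
    have hM : M 0 j = A a j := rfl
    rw [hM, minorVector]
    ring
  rw [this, h0]
  simp

theorem boundaries_le_cycles {i : ℤ} : X.boundaries i ≤ X.cycles i := by
  rintro _ ⟨c, rfl⟩
  rw [cycles, LinearMap.mem_ker]
  simp [X.bd_mul_bd]

section Winding

variable {i : ℤ} [LinearOrder (X.cells i)]

/-- The increasing enumeration of the `i`-cells of a cycletree. -/
def Cycletree.enum (U : X.Cycletree i) : Fin (X.cycleRank (i - 1) + 1) → X.cells i :=
  U.1.orderEmbOfFin U.2

/-- The submatrix of `[∂ᵢ]_Z` consisting of the columns indexed by `I(U)`. -/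
def Cycletree.matrix (Z : Module.Basis (Fin (X.cycleRank (i - 1))) ℤ (X.cycles (i - 1)))
    (U : X.Cycletree i) :
    Matrix (Fin (X.cycleRank (i - 1))) (Fin (X.cycleRank (i - 1) + 1)) ℤ :=
  (boundaryMatrix Z).submatrix id U.enum

/-- The chain underlying `C_U`: the minor vector of the columns indexed by `I(U)`, extended by zero
to all `i`-cells. -/
def Cycletree.chain (Z : Module.Basis (Fin (X.cycleRank (i - 1))) ℤ (X.cycles (i - 1)))
    (U : X.Cycletree i) : X.cells i → ℤ :=
  ∑ j, Pi.single (U.enum j) (minorVector (U.matrix Z) j)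

theorem Cycletree.chain_mem_cycles
    (Z : Module.Basis (Fin (X.cycleRank (i - 1))) ℤ (X.cycles (i - 1)))
    (U : X.Cycletree i) : U.chain Z ∈ X.cycles i := by
  have key : ∑ j, minorVector (U.matrix Z) j • boundaryColumn (U.enum j) = 0 := by
    apply Z.repr.injective
    ext a
    have h := congrFun (mulVec_minorVector (U.matrix Z)) a
    rw [Matrix.mulVec, dotProduct] at h
    simpa [matrix, boundaryMatrix, mul_comm] using h
  rw [CellComplex.cycles, LinearMap.mem_ker]
  ext y
  have h := congrFun (congrArg Subtype.val key) y
  simpa [chain, boundaryColumn, mul_comm, Matrix.mulVec_sum] using h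

/-- The cycle part `C_U ∈ Zᵢ(X)` of a cycletree `U`. -/
def Cycletree.cycle (Z : Module.Basis (Fin (X.cycleRank (i - 1))) ℤ (X.cycles (i - 1)))
    (U : X.Cycletree i) : X.cycles i :=
  ⟨U.chain Z, U.chain_mem_cycles Z⟩

/-- The winding number `w(z) = det([z]_W, [∂̄ᵢ₊₁]_W)`, where `W` is a basis of `Zᵢ(X)` and the
columns of `∂̄ᵢ₊₁` are a basis `B` of the group `Bᵢ(X) = im ∂ᵢ₊₁`. -/
def windingNumber {m : ℕ} (W : Module.Basis (Fin (m + 1)) ℤ (X.cycles i))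
    (B : Module.Basis (Fin m) ℤ (X.boundaries i)) (z : X.cycles i) : ℤ :=
  (W.toMatrix (Fin.cons z fun j => Submodule.inclusion boundaries_le_cycles (B j))).det

/-- The standard harmonic cycle `λ = ∑_U w(C_U) C_U`, over all `i`-dimensional cycletrees `U`. -/
def standardHarmonicCycle
    (Z : Module.Basis (Fin (X.cycleRank (i - 1))) ℤ (X.cycles (i - 1))) {m : ℕ}
    (W : Module.Basis (Fin (m + 1)) ℤ (X.cycles i))
    (B : Module.Basis (Fin m) ℤ (X.boundaries i)) : X.cycles i :=
  ∑ U : X.Cycletree i, windingNumber W B (U.cycle Z) • U.cycle Z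

end Winding

/-- If `rk H̃ᵢ(X) = 1`, then `Zᵢ(X)` and `Bᵢ(X)` have bases of sizes `m + 1` and `m`. -/
theorem exists_bases {i : ℤ} (h : Module.finrank ℤ (X.RedHomology i) = 1) :
    ∃ m : ℕ, Nonempty (Module.Basis (Fin (m + 1)) ℤ (X.cycles i)) ∧
      Nonempty (Module.Basis (Fin m) ℤ (X.boundaries i)) := by
  have h1 := Submodule.finrank_quotient_add_finrank
    ((X.boundaries i).submoduleOf (X.cycles i))
  have h2 := (Submodule.submoduleOfEquivOfLe (boundaries_le_cycles (X := X) (i := i))).finrank_eq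
  refine ⟨Module.finrank ℤ (X.boundaries i), ⟨?_⟩, ⟨Module.finBasis ℤ _⟩⟩
  refine Module.finBasisOfFinrankEq ℤ _ ?_
  rw [h, h2] at h1
  rw [← h1, add_comm]

end CellComplex

end

/-! Write $A=[\partial_i]_Z$, $a=\det(AA^t)$, and let $G$ and $d$ be the Gram determinants of bases
of $Z_i$ and $B_i$. The core is the identity $\sum_U (z\circ C_U)\,C_U = a\,z$ for $z\in Z_i$
(`sum_dotProduct_chain_smul_cycle`), a case of Cauchy–Binet. Applying the linear functional $w$
gives $\lambda\circ z = a\,w(z)$ (`standardHarmonicCycle_dotProduct`). As $w$ kills boundaries,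
$\lambda$ is orthogonal to $B_i$, and the Gram determinant of $\lambda,b_1,\dots,b_m$ yields
$w(\lambda)^2G=(\lambda\circ\lambda)\,d$ (`windingNumber_sq_mul_det`).

With $\lambda\circ\lambda=a\,w(\lambda)$ this gives $(\lambda\circ\lambda)\,G=a^2d$. It remains to
identify the constants: $a=k_i(X)$ by the matrix-tree theorem (`treeNumber_eq_det`), $d=k^i(X)$
(`dualTreeNumber_eq_det`), and $a=|\widetilde H_{i-1}(X)|^2\,G$
(`det_boundaryMatrix_mul_transpose`), the last because a surjective integer matrix and a basis of
its kernel have equal Gram determinants. -/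

open Matrix

/-! ### Cauchy–Binet. -/

/-- The Cauchy–Binet formula. -/
theorem Matrix.det_mul_transpose_eq_sum_minors {R α : Type*} [CommRing R] [Fintype α]
    [LinearOrder α] {n : ℕ} (A B : Matrix (Fin n) α R) :
    (A * Bᵀ).det = ∑ I : {I : Finset α // I.card = n},
      (A.submatrix id (I.1.orderEmbOfFin I.2)).det *
        (B.submatrix id (I.1.orderEmbOfFin I.2)).det := by
  have hrow : (A * Bᵀ).det = detRowAlternating fun r => ∑ x, A r x • Bᵀ x := by
    change detRowAlternating (A * Bᵀ) = _
    congr 1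
    ext r s
    simp [Matrix.mul_apply]
  -- Multilinear expansion gives a sum over all maps `Fin n → α`. The injective ones correspond
  -- uniquely to pairs (image `I`, permutation `σ`); on the others the alternating form vanishes.
  rw [hrow, ← AlternatingMap.coe_multilinearMap, MultilinearMap.map_sum]
  simp only [MultilinearMap.map_smul_univ]
  have hminor : ∀ I : {I : Finset α // I.card = n},
      (A.submatrix id (I.1.orderEmbOfFin I.2)).det *
        (B.submatrix id (I.1.orderEmbOfFin I.2)).det =
      ∑ σ : Equiv.Perm (Fin n),
        (∏ r, A r (I.1.orderEmbOfFin I.2 (σ r))) •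
          detRowAlternating.toMultilinearMap fun r => Bᵀ (I.1.orderEmbOfFin I.2 (σ r)) := by
    intro I
    rw [← det_transpose (A.submatrix _ _), det_apply, Finset.sum_mul]
    refine Finset.sum_congr rfl fun σ _ => ?_
    have h : (detRowAlternating.toMultilinearMap fun r => Bᵀ (I.1.orderEmbOfFin I.2 (σ r))) =
        ((B.submatrix id (I.1.orderEmbOfFin I.2))ᵀ.submatrix σ id).det := rfl
    rw [h, det_permute, det_transpose]
    simp [Units.smul_def, zsmul_eq_mul]
    ring
  simp only [hminor]
  rw [← Fintype.sum_sigma' fun (I : {I : Finset α // I.card = n}) (σ : Equiv.Perm (Fin n)) =>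
    (∏ r, A r (I.1.orderEmbOfFin I.2 (σ r))) •
      detRowAlternating.toMultilinearMap fun r => Bᵀ (I.1.orderEmbOfFin I.2 (σ r))]
  symm
  refine Finset.sum_of_injOn
    (fun p : (Σ _ : {I : Finset α // I.card = n}, Equiv.Perm (Fin n)) =>
      fun r => p.1.1.orderEmbOfFin p.1.2 (p.2 r)) ?_ (by simp) ?_ (fun _ _ => rfl)
  · rintro ⟨I, σ⟩ _ ⟨J, τ⟩ _ h
    have hIJ : I = J := by
      apply Subtype.ext
      have h1 : Set.range (fun r => I.1.orderEmbOfFin I.2 (σ r)) = I.1 := by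
        rw [← I.1.range_orderEmbOfFin I.2]
        exact σ.surjective.range_comp (I.1.orderEmbOfFin I.2)
      have h2 : Set.range (fun r => J.1.orderEmbOfFin J.2 (τ r)) = J.1 := by
        rw [← J.1.range_orderEmbOfFin J.2]
        exact τ.surjective.range_comp (J.1.orderEmbOfFin J.2)
      have h3 := congrArg Set.range h
      dsimp only at h3
      rw [h1, h2] at h3
      exact_mod_cast h3
    subst hIJ
    congr 1
    ext r
    exact congrArg Fin.val ((I.1.orderEmbOfFin I.2).injective (congrFun h r))
  · intro f _ hf
    have hninj : ¬ Function.Injective f := by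
      intro hinj
      apply hf
      have hc : (Finset.univ.image f).card = n := by
        rw [Finset.card_image_of_injective _ hinj, Finset.card_univ, Fintype.card_fin]
      have hex : ∀ r, ∃ s, (Finset.univ.image f).orderEmbOfFin hc s = f r := by
        intro r
        have : f r ∈ Set.range ((Finset.univ.image f).orderEmbOfFin hc) := by
          rw [Finset.range_orderEmbOfFin]; simp
        exact this
      choose σ hσ using hex
      have hσi : Function.Injective σ := fun a b hab => hinj (by rw [← hσ, ← hσ, hab])
      refine ⟨⟨⟨_, hc⟩, Equiv.ofBijective σ (Finite.injective_iff_bijective.1 hσi)⟩, by simp, ?_⟩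
      ext r
      exact hσ r
    have : (detRowAlternating.toMultilinearMap fun r => Bᵀ (f r)) = 0 := by
      rw [Function.not_injective_iff] at hninj
      obtain ⟨a, b, hab, hne⟩ := hninj
      exact AlternatingMap.map_eq_zero_of_eq _ _ (by simp only [hab]) hne
    rw [this, smul_zero]

theorem Matrix.det_of_column_zero {R : Type*} [CommRing R] {n : ℕ}
    (M : Matrix (Fin (n + 1)) (Fin (n + 1)) R) (h : ∀ r : Fin n, M r.succ 0 = 0) :
    M.det = M 0 0 * (M.submatrix Fin.succ Fin.succ).det := by
  rw [det_succ_column_zero, Fin.sum_univ_succ]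
  simp [h]

/-! ### Ranks and Gram determinants of integer matrices. -/

theorem Matrix.transpose_mul_self_mulVec_eq_zero {α β : Type*} [Fintype α] [Fintype β]
    (M : Matrix α β ℤ) (v : β → ℤ) : (Mᵀ * M) *ᵥ v = 0 ↔ M *ᵥ v = 0 := by
  rw [← mulVec_mulVec]
  refine ⟨fun h => ?_, fun h => by rw [h, mulVec_zero]⟩
  replace h := congrArg (dotProduct v) h
  rwa [dotProduct_mulVec, dotProduct_zero, vecMul_transpose, dotProduct_self_eq_zero] at h

theorem Matrix.rank_add_finrank_ker {α β : Type*} [Fintype β] (M : Matrix α β ℤ) :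
    M.rank + Module.finrank ℤ (LinearMap.ker M.mulVecLin) = Fintype.card β := by
  have h := Submodule.finrank_quotient_add_finrank (LinearMap.ker M.mulVecLin)
  rwa [M.mulVecLin.quotKerEquivRange.finrank_eq, Module.finrank_fintype_fun_eq_card] at h

/-- `Mᵀ * M` and `M` have the same kernel, hence the same rank, and the rank of a product is at most
that of its left factor. -/
theorem Matrix.rank_le_rank_transpose {α β : Type*} [Fintype α] [Fintype β]
    (M : Matrix α β ℤ) : M.rank ≤ Mᵀ.rank := by
  have hker : LinearMap.ker (Mᵀ * M).mulVecLin = LinearMap.ker M.mulVecLin := by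
    ext v
    exact M.transpose_mul_self_mulVec_eq_zero v
  have h1 := (Mᵀ * M).rank_add_finrank_ker
  have h2 := M.rank_add_finrank_ker
  rw [hker] at h1
  have h3 := rank_mul_le_left Mᵀ M
  omega

theorem Matrix.rank_transpose_int {α β : Type*} [Fintype α] [Fintype β]
    (M : Matrix α β ℤ) : Mᵀ.rank = M.rank :=
  le_antisymm Mᵀ.rank_le_rank_transpose M.rank_le_rank_transpose

theorem Matrix.det_transpose_mul_self_nonneg {α β : Type*} [Fintype α] [Fintype β] [DecidableEq β]
    (M : Matrix α β ℤ) : 0 ≤ (Mᵀ * M).det := by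
  have h := (posSemidef_conjTranspose_mul_self (M.map (Int.cast : ℤ → ℝ))).det_nonneg
  have h2 : ((Mᵀ * M).det : ℝ) = ((M.map (Int.cast : ℤ → ℝ))ᴴ * M.map (Int.cast : ℤ → ℝ)).det := by
    rw [Int.cast_det]
    congr 1
    ext a b
    simp [Matrix.mul_apply]
  rw [← h2] at h
  exact_mod_cast h

theorem Matrix.det_transpose_mul_self_ne_zero {α β : Type*} [Fintype α] [Fintype β]
    [DecidableEq β] (M : Matrix α β ℤ) (hM : Function.Injective M.mulVec) :
    (Mᵀ * M).det ≠ 0 := by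
  intro h
  obtain ⟨v, hv, hv0⟩ := exists_mulVec_eq_zero_iff.2 h
  rw [transpose_mul_self_mulVec_eq_zero] at hv0
  exact hv (hM (by rw [hv0, mulVec_zero]))

/-! ### Sublattices of `α → ℤ` and their bases. -/

/-- The matrix whose columns are the vectors of a family in a submodule of `α → ℤ`. -/
def Submodule.columnMatrix {α ι : Type*} {K : Submodule ℤ (α → ℤ)} (b : ι → K) : Matrix α ι ℤ :=
  Matrix.of fun x a => (b a : α → ℤ) x

theorem Submodule.columnMatrix_mulVec {α ι : Type*} [Fintype ι] {K : Submodule ℤ (α → ℤ)}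
    (b : ι → K) (v : ι → ℤ) : columnMatrix b *ᵥ v = ((∑ a, v a • b a : K) : α → ℤ) := by
  ext x
  simp [columnMatrix, mulVec, dotProduct, mul_comm]

theorem Submodule.columnMatrix_mulVec_repr {α ι : Type*} [Fintype ι] {K : Submodule ℤ (α → ℤ)}
    (b : Module.Basis ι ℤ K) (z : K) : columnMatrix b *ᵥ b.repr z = (z : α → ℤ) := by
  rw [columnMatrix_mulVec, b.sum_repr]

theorem Submodule.columnMatrix_mulVec_injective {α ι : Type*} [Fintype ι]
    {K : Submodule ℤ (α → ℤ)} (b : Module.Basis ι ℤ K) :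
    Function.Injective (columnMatrix b).mulVec := by
  intro v w h
  rw [columnMatrix_mulVec, columnMatrix_mulVec] at h
  have h' := congrArg (fun z => ⇑(b.repr z)) (Subtype.ext h)
  simpa only [b.repr_sum_self] using h'

theorem Submodule.columnMatrix_eq_mul_toMatrix {α ι κ : Type*} [Fintype ι]
    {K : Submodule ℤ (α → ℤ)} (b : Module.Basis ι ℤ K) (c : κ → K) :
    columnMatrix c = columnMatrix b * b.toMatrix c := by
  ext x a
  have h := congrFun (columnMatrix_mulVec_repr b (c a)) x
  exact h.symm

theorem Matrix.mul_left_cancel_of_mulVec_injective {R α κ τ : Type*} [CommRing R] [Fintype κ]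
    {W : Matrix α κ R} (hW : Function.Injective W.mulVec) {P Q : Matrix κ τ R}
    (h : W * P = W * Q) : P = Q := by
  ext a t
  exact congrFun (hW (funext fun y => congrFun (congrFun h y) t) :
    (fun a => P a t) = fun a => Q a t) a

/-- A surjective integer matrix has the same Gram determinant as a basis of its kernel. -/
theorem Matrix.det_mul_transpose_eq_det_gram_ker {α ι κ : Type*} [Fintype α] [DecidableEq α]
    [Fintype ι] [DecidableEq ι] [Fintype κ] [DecidableEq κ] (A : Matrix ι α ℤ)
    (hA : Function.Surjective A.mulVec) {K : Submodule ℤ (α → ℤ)}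
    (hK : ∀ x, x ∈ K ↔ A *ᵥ x = 0) (b : Module.Basis κ ℤ K) :
    (A * Aᵀ).det = ((Submodule.columnMatrix b)ᵀ * Submodule.columnMatrix b).det := by
  obtain ⟨S, hS⟩ := mulVec_surjective_iff_exists_right_inverse.1 hA
  set W := Submodule.columnMatrix b with hW
  have hAW : A * W = 0 := by
    ext r a
    exact congrFun ((hK _).1 (b a).2) r
  have hmem : ∀ x, (1 - S * A).col x ∈ K := by
    intro x
    rw [hK]
    have : A * (1 - S * A) = 0 := by rw [Matrix.mul_sub, ← Matrix.mul_assoc, hS]; simp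
    ext r
    exact congrFun (congrFun this r) x
  let V : Matrix κ α ℤ := Matrix.of fun a x => b.repr ⟨_, hmem x⟩ a
  have hWV : W * V = 1 - S * A := by
    ext y x
    exact congrFun (Submodule.columnMatrix_mulVec_repr b ⟨_, hmem x⟩) y
  have hWinj := Submodule.columnMatrix_mulVec_injective b
  have hVW : V * W = 1 := by
    apply mul_left_cancel_of_mulVec_injective hWinj
    rw [← Matrix.mul_assoc, hWV, Matrix.sub_mul, Matrix.mul_assoc, hAW]; simp [hW]
  have hVS : V * S = 0 := by
    apply mul_left_cancel_of_mulVec_injective hWinj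
    rw [← Matrix.mul_assoc, hWV, Matrix.sub_mul, Matrix.mul_assoc, hS]; simp
  -- `P` joins a section of `A` to the kernel basis, and `R` is its two-sided inverse. `Q * Qᵀ` is
  -- block diagonal and `Q * P` block triangular, so `Q = (Q * P) * R` gives
  -- $\det(AA^t)\det(W^tW)=\det(W^tW)^2$.
  let P : Matrix α (ι ⊕ κ) ℤ := fromCols S W
  let R : Matrix (ι ⊕ κ) α ℤ := fromRows A V
  let Q : Matrix (ι ⊕ κ) α ℤ := fromRows A Wᵀ
  have hPR : P * R = 1 := by
    rw [fromCols_mul_fromRows, hWV]; abel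
  have hRP : R * P = 1 := by
    rw [fromRows_mul_fromCols, hS, hAW, hVS, hVW, fromBlocks_one]
  -- `R` has different row and column index types, so the unit determinant is taken of `R * Rᵀ`: it
  -- has inverse `Pᵀ * P`, and its determinant is nonnegative.
  have hunit : (R * Rᵀ).det = 1 := by
    have h1 : (Pᵀ * P) * (R * Rᵀ) = 1 := by
      rw [Matrix.mul_assoc, ← Matrix.mul_assoc P, hPR, Matrix.one_mul, ← transpose_mul, hRP, transpose_one]
    have h2 := congrArg det h1
    rw [det_mul, det_one] at h2
    have h3 := det_transpose_mul_self_nonneg Rᵀ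
    rw [transpose_transpose] at h3
    rcases Int.eq_one_or_neg_one_of_mul_eq_one (by rw [mul_comm]; exact h2) with h | h
    · exact h
    · omega
  have hQP : (Q * P).det = (Wᵀ * W).det := by
    rw [fromRows_mul_fromCols, hS, hAW, det_fromBlocks_zero₁₂, det_one, one_mul]
  have hQQ : (Q * Qᵀ).det = (A * Aᵀ).det * (Wᵀ * W).det := by
    rw [transpose_fromRows, fromRows_mul_fromCols, transpose_transpose, hAW,
      det_fromBlocks_zero₁₂]
  have hfac : Q * Qᵀ = (Q * P) * (R * Rᵀ) * (Q * P)ᵀ := by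
    have : (Q * P) * R = Q := by rw [Matrix.mul_assoc, hPR, Matrix.mul_one]
    rw [← Matrix.mul_assoc, this, Matrix.mul_assoc, ← transpose_mul, this]
  rw [hfac, det_mul, det_mul, hunit, det_transpose, hQP, mul_one] at hQQ
  exact (mul_right_cancel₀ (det_transpose_mul_self_ne_zero W hWinj) hQQ).symm

theorem Module.Basis.det_toMatrix_ne_zero_of_linearIndependent {ι M : Type*} [Fintype ι]
    [DecidableEq ι] [AddCommGroup M] [Module ℤ M] (b : Module.Basis ι ℤ M) {v : ι → M}
    (hv : LinearIndependent ℤ v) : (b.toMatrix v).det ≠ 0 := by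
  intro h
  obtain ⟨c, hc, hc0⟩ := exists_mulVec_eq_zero_iff.2 h
  apply hc
  rw [Fintype.linearIndependent_iff] at hv
  refine funext (hv c (b.repr.injective ?_))
  ext a
  have := congrFun hc0 a
  simpa [mulVec, dotProduct, toMatrix_apply, mul_comm] using this

theorem Module.Basis.linearIndependent_of_det_toMatrix_ne_zero {ι M : Type*} [Fintype ι]
    [DecidableEq ι] [AddCommGroup M] [Module ℤ M] (b : Module.Basis ι ℤ M) {v : ι → M}
    (h : (b.toMatrix v).det ≠ 0) : LinearIndependent ℤ v := by
  rw [Fintype.linearIndependent_iff]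
  intro c hc
  refine congrFun (eq_zero_of_mulVec_eq_zero h ?_)
  ext a
  have := DFunLike.congr_fun (congrArg b.repr hc) a
  simpa [mulVec, dotProduct, toMatrix_apply, mul_comm] using this

/-- The kernel of a linear map between finite free abelian groups is a direct summand. -/
theorem LinearMap.exists_retraction_ker {M N : Type*} [AddCommGroup M] [AddCommGroup N]
    [Module.Free ℤ N] [Module.Finite ℤ N] (f : M →ₗ[ℤ] N) :
    ∃ p : M →ₗ[ℤ] LinearMap.ker f, ∀ z : LinearMap.ker f, p z = z := by
  -- The image lies in a finite free group, so it is free and `f` splits over it; `id - s ∘ f` is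
  -- the projection onto the kernel.
  obtain ⟨s, hs⟩ := Module.projective_lifting_property f.rangeRestrict LinearMap.id
    f.surjective_rangeRestrict
  have hs' : ∀ y, f (s y) = y := fun y => congrArg Subtype.val (LinearMap.congr_fun hs y)
  have hmem : ∀ x, (LinearMap.id - s ∘ₗ f.rangeRestrict : M →ₗ[ℤ] M) x ∈ LinearMap.ker f := by
    intro x
    simp [hs']
  refine ⟨LinearMap.codRestrict (LinearMap.ker f) _ hmem, fun z => ?_⟩
  have hz : f.rangeRestrict (z : M) = 0 := Subtype.ext z.2
  apply Subtype.ext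
  simp [hz]

namespace CellComplex

variable {X : CellComplex.{u}} {i : ℤ}

theorem columnMatrix_mul_boundaryMatrix {r : ℕ}
    (Z : Module.Basis (Fin r) ℤ (X.cycles (i - 1))) :
    X.bd (i - 1) i = Submodule.columnMatrix Z * boundaryMatrix Z :=
  Submodule.columnMatrix_eq_mul_toMatrix Z boundaryColumn

theorem mem_cycles_iff {r : ℕ} (Z : Module.Basis (Fin r) ℤ (X.cycles (i - 1)))
    (x : X.cells i → ℤ) : x ∈ X.cycles i ↔ boundaryMatrix Z *ᵥ x = 0 := by
  rw [cycles, LinearMap.mem_ker, mulVecLin_apply, columnMatrix_mul_boundaryMatrix Z,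
    ← mulVec_mulVec]
  refine ⟨fun h => Submodule.columnMatrix_mulVec_injective Z (by rw [h, mulVec_zero]),
    fun h => by rw [h, mulVec_zero]⟩

theorem finrank_redHomology_add (j : ℤ) :
    Module.finrank ℤ (X.RedHomology j) + Module.finrank ℤ (X.boundaries j) =
      Module.finrank ℤ (X.cycles j) := by
  rw [← Submodule.finrank_quotient_add_finrank ((X.boundaries j).submoduleOf (X.cycles j)),
    (Submodule.submoduleOfEquivOfLe (boundaries_le_cycles (X := X) (i := j))).finrank_eq]

/-! ### Homology in degree `i - 1` as a quotient by spans of boundary columns. -/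

section Homology

/-- The variable `j` absorbs the mismatch between `i - 1 + 1`, which occurs in `boundaries`, and
`i`. -/
theorem map_chains_spanningSubcomplex (I : Finset (X.cells i)) {j : ℤ} (hj : j = i) :
    ((spanningSubcomplex I).chains j).map (X.bd (i - 1) j).mulVecLin =
      (Submodule.span ℤ (boundaryColumn '' (I : Set (X.cells i)))).map
        (X.cycles (i - 1)).subtype := by
  classical
  subst hj
  apply le_antisymm
  · rintro _ ⟨c, hc, rfl⟩
    have hsum : (X.bd (j - 1) j).mulVecLin c =
        (X.cycles (j - 1)).subtype (∑ x, c x • boundaryColumn x) := by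
      ext y
      simp [mulVec, dotProduct, boundaryColumn, mul_comm]
    rw [hsum]
    refine Submodule.mem_map_of_mem (Submodule.sum_mem _ fun x _ => ?_)
    by_cases hx : x ∈ I
    · exact Submodule.smul_mem _ _ (Submodule.subset_span ⟨x, hx, rfl⟩)
    · have : c x = 0 := hc x (by simpa [spanningSubcomplex] using hx)
      rw [this, zero_smul]
      exact zero_mem _
  · rw [Submodule.map_le_iff_le_comap, Submodule.span_le]
    rintro _ ⟨x, hx, rfl⟩
    refine ⟨Pi.single x 1, fun y hy => ?_, ?_⟩
    · rw [Pi.single_apply, if_neg]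
      rintro rfl
      exact hy (Or.inr ⟨rfl, hx⟩)
    · ext y
      simp [boundaryColumn]

theorem boundaries_submoduleOf_spanningSubcomplex (I : Finset (X.cells i)) :
    ((spanningSubcomplex I).boundaries (i - 1)).submoduleOf (X.cycles (i - 1)) =
      Submodule.span ℤ (boundaryColumn '' (I : Set (X.cells i))) := by
  rw [Subcomplex.boundaries, map_chains_spanningSubcomplex I (sub_add_cancel i 1),
    Submodule.submoduleOf, Submodule.comap_map_eq_of_injective (Submodule.injective_subtype _)]

theorem boundaries_submoduleOf_cycles :
    (X.boundaries (i - 1)).submoduleOf (X.cycles (i - 1)) =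
      Submodule.span ℤ (Set.range (boundaryColumn (X := X) (i := i))) := by
  have h : X.boundaries (i - 1) =
      (spanningSubcomplex (Finset.univ : Finset (X.cells i))).boundaries (i - 1) := by
    have htop : (spanningSubcomplex (Finset.univ : Finset (X.cells i))).chains (i - 1 + 1) = ⊤ := by
      rw [eq_top_iff]
      exact fun c _ x hx => (hx (Or.inr ⟨sub_add_cancel i 1, Finset.mem_univ _⟩)).elim
    rw [boundaries, Subcomplex.boundaries, htop, LinearMap.range_eq_map]
  rw [h, boundaries_submoduleOf_spanningSubcomplex, Finset.coe_univ, Set.image_univ]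

theorem card_redHomology_spanningSubcomplex (I : Finset (X.cells i)) :
    Nat.card ((spanningSubcomplex I).RedHomology (i - 1)) =
      Nat.card (X.cycles (i - 1) ⧸
        Submodule.span ℤ (boundaryColumn '' (I : Set (X.cells i)))) := by
  have hcycles : (spanningSubcomplex I).cycles (i - 1) = X.cycles (i - 1) := by
    refine inf_eq_left.2 fun c _ x hx => (hx (Or.inl ?_)).elim
    omega
  have key : ∀ (Q P : Submodule ℤ (X.cells (i - 1) → ℤ)), P = X.cycles (i - 1) →
      Nat.card (P ⧸ Q.submoduleOf P) =
        Nat.card (X.cycles (i - 1) ⧸ Q.submoduleOf (X.cycles (i - 1))) := by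
    rintro Q _ rfl
    rfl
  rw [Subcomplex.RedHomology, key _ _ hcycles, boundaries_submoduleOf_spanningSubcomplex]

/-- If `rk H̃ᵢ₋₁(X) = 0`, the Gram determinant of the rows of `[∂ᵢ]_Z` is `|H̃ᵢ₋₁(X)|²` times that
of a basis of `Zᵢ(X)`. -/
theorem det_boundaryMatrix_mul_transpose
    (h_pred : Module.finrank ℤ (X.RedHomology (i - 1)) = 0)
    (Z : Module.Basis (Fin (X.cycleRank (i - 1))) ℤ (X.cycles (i - 1)))
    {κ : Type*} [Fintype κ] [DecidableEq κ] (W : Module.Basis κ ℤ (X.cycles i)) :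
    (boundaryMatrix Z * (boundaryMatrix Z)ᵀ).det =
        (Nat.card (X.RedHomology (i - 1)) : ℤ) ^ 2 *
          ((Submodule.columnMatrix W)ᵀ * Submodule.columnMatrix W).det ∧
      Nat.card (X.RedHomology (i - 1)) ≠ 0 := by
  classical
  -- `N` is $B_{i-1}$ inside $Z_{i-1}$, of full rank by `h_pred`. Reading the columns in a basis of
  -- `N` factors $[\partial_i]_Z$ as `H * A'`, where $|\det H|$ is the index of `N`, and `A'` is
  -- surjective with kernel $Z_i$.
  set N := Submodule.span ℤ (Set.range (boundaryColumn (X := X) (i := i))) with hN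
  have hcard : Nat.card (X.RedHomology (i - 1)) = Nat.card (X.cycles (i - 1) ⧸ N) := by
    rw [hN, ← boundaries_submoduleOf_cycles]
  have hrank : Module.finrank ℤ N = X.cycleRank (i - 1) := by
    have h := Submodule.finrank_quotient_add_finrank N
    have h0 : Module.finrank ℤ (X.cycles (i - 1) ⧸ N) = 0 := by
      rw [hN, ← boundaries_submoduleOf_cycles]
      exact h_pred
    rwa [h0, zero_add] at h
  let bN : Module.Basis (Fin (X.cycleRank (i - 1))) ℤ N := Module.finBasisOfFinrankEq ℤ N hrank
  set H := Z.toMatrix (fun a => (bN a : X.cycles (i - 1))) with hH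
  have hdet : H.det.natAbs = Nat.card (X.RedHomology (i - 1)) := by
    rw [hcard]
    exact Submodule.natAbs_det_basis_change Z N bN
  have hdet0 : H.det ≠ 0 :=
    Z.det_toMatrix_ne_zero_of_linearIndependent
      (bN.linearIndependent.map' N.subtype N.ker_subtype)
  let col : X.cells i → N := fun x => ⟨boundaryColumn x, Submodule.subset_span ⟨x, rfl⟩⟩
  let A' : Matrix (Fin (X.cycleRank (i - 1))) (X.cells i) ℤ := bN.toMatrix col
  have hA : boundaryMatrix Z = H * A' := by
    ext a x
    have h := congrArg (fun z : N => Z.repr (z : X.cycles (i - 1)) a) (bN.sum_repr (col x))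
    simp only [Submodule.coe_sum, Submodule.coe_smul, map_sum, map_smul, Finsupp.coe_finsetSum,
      Finset.sum_apply, Finsupp.smul_apply, smul_eq_mul] at h
    rw [mul_apply]
    refine Eq.trans h.symm (Finset.sum_congr rfl fun b _ => mul_comm _ _)
  have hsurj : Function.Surjective A'.mulVec := by
    intro v
    obtain ⟨c, hc⟩ := (Submodule.mem_span_range_iff_exists_fun ℤ).1 (∑ a, v a • bN a : N).2
    refine ⟨c, ?_⟩
    have hc' : ∑ x, c x • col x = ∑ a, v a • bN a := Subtype.ext (by simpa [col] using hc)
    have h := congrArg (fun z => ⇑(bN.repr z)) hc'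
    simp only [bN.repr_sum_self] at h
    rw [← h]
    ext a
    simp [A', mulVec, dotProduct, Module.Basis.toMatrix_apply, mul_comm]
  have hK : ∀ x, x ∈ X.cycles i ↔ A' *ᵥ x = 0 := by
    intro x
    rw [mem_cycles_iff Z, hA, ← mulVec_mulVec]
    exact ⟨eq_zero_of_mulVec_eq_zero hdet0, fun h => by rw [h, mulVec_zero]⟩
  refine ⟨?_, by rw [← hdet]; exact Int.natAbs_ne_zero.2 hdet0⟩
  rw [← det_mul_transpose_eq_det_gram_ker A' hsurj hK W, hA, ← hdet, Int.natCast_natAbs, sq_abs,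
    transpose_mul, Matrix.mul_assoc, ← Matrix.mul_assoc A', det_mul, det_mul, det_transpose]
  ring

end Homology

/-! ### The matrix-tree theorem. -/

section TreeNumber

/-- Independence over `ℤ` and over its fraction field agree, and $Z_{i-1}$ embeds in the rational
vectors. -/
theorem linearIndepOn_ratColumn_iff (I : Finset (X.cells i)) :
    LinearIndepOn ℚ (ratColumn (X := X) (n := i)) (I : Set (X.cells i)) ↔
      LinearIndepOn ℤ (boundaryColumn (X := X) (i := i)) (I : Set (X.cells i)) := by
  let φ : X.cycles (i - 1) →ₗ[ℤ] (X.cells (i - 1) → ℚ) :=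
    { toFun := fun z y => ((z : X.cells (i - 1) → ℤ) y : ℚ)
      map_add' := fun a b => by ext y; simp
      map_smul' := fun c a => by ext y; simp }
  have hφ : LinearMap.ker φ = ⊥ := by
    rw [LinearMap.ker_eq_bot]
    intro a b h
    ext y
    exact Int.cast_injective (α := ℚ) (congrFun h y)
  rw [LinearIndepOn, ← LinearIndependent.iff_fractionRing ℤ ℚ, LinearIndepOn,
    ← φ.linearIndependent_iff hφ]
  rfl

variable [LinearOrder (X.cells i)]

theorem linearIndepOn_boundaryColumn_iff {r : ℕ}
    (Z : Module.Basis (Fin r) ℤ (X.cycles (i - 1))) (I : Finset (X.cells i)) (hI : I.card = r) :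
    LinearIndepOn ℤ (boundaryColumn (X := X) (i := i)) (I : Set (X.cells i)) ↔
      ((boundaryMatrix Z).submatrix id (I.orderEmbOfFin hI)).det ≠ 0 := by
  have h : LinearIndepOn ℤ (boundaryColumn (X := X) (i := i)) (I : Set (X.cells i)) ↔
      LinearIndependent ℤ (boundaryColumn ∘ I.orderEmbOfFin hI) :=
    (linearIndependent_equiv (R := ℤ) (f := fun x : I => boundaryColumn x.1)
      (I.orderIsoOfFin hI).toEquiv).symm
  rw [h]
  exact ⟨Z.det_toMatrix_ne_zero_of_linearIndependent,
    Z.linearIndependent_of_det_toMatrix_ne_zero⟩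

/-- A nonzero maximal minor is, up to sign, the index in $Z_{i-1}$ of the lattice spanned by its
columns, and these columns span $B_{i-1}(X_I)$. Thus each nonzero Cauchy–Binet term is a tree's
weight. -/
theorem card_redHomology_eq_natAbs_det {r : ℕ}
    (Z : Module.Basis (Fin r) ℤ (X.cycles (i - 1))) (I : Finset (X.cells i)) (hI : I.card = r)
    (hdet : ((boundaryMatrix Z).submatrix id (I.orderEmbOfFin hI)).det ≠ 0) :
    Nat.card ((spanningSubcomplex I).RedHomology (i - 1)) =
      ((boundaryMatrix Z).submatrix id (I.orderEmbOfFin hI)).det.natAbs := by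
  have hli : LinearIndependent ℤ (boundaryColumn ∘ I.orderEmbOfFin hI) :=
    Z.linearIndependent_of_det_toMatrix_ne_zero hdet
  have hspan : Submodule.span ℤ (boundaryColumn '' (I : Set (X.cells i))) =
      Submodule.span ℤ (Set.range (boundaryColumn ∘ I.orderEmbOfFin hI)) := by
    rw [Set.range_comp, Finset.range_orderEmbOfFin]
  rw [card_redHomology_spanningSubcomplex, hspan,
    ← Submodule.natAbs_det_basis_change Z _ (Module.Basis.span hli)]
  congr 1
  rw [Module.Basis.det_apply]
  congr 1
  ext a b
  simp [Module.Basis.toMatrix_apply, Module.Basis.span_apply, boundaryMatrix]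

/-- The upper bound comes from factoring $\partial_i$ through rank `r`; the lower one from
Cauchy–Binet, as `hA` forces some maximal minor to be nonzero. -/
theorem finrank_span_ratColumn {r : ℕ} (Z : Module.Basis (Fin r) ℤ (X.cycles (i - 1)))
    (hA : (boundaryMatrix Z * (boundaryMatrix Z)ᵀ).det ≠ 0) :
    Module.finrank ℚ (Submodule.span ℚ (Set.range (ratColumn (X := X) (n := i)))) = r := by
  apply le_antisymm
  · have hmul : (X.bd (i - 1) i).map (Int.cast : ℤ → ℚ) =
        (Submodule.columnMatrix Z).map (Int.cast : ℤ → ℚ) *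
          (boundaryMatrix Z).map (Int.cast : ℤ → ℚ) := by
      ext y x
      simp [columnMatrix_mul_boundaryMatrix Z, Matrix.mul_apply]
    have h1 := rank_mul_le_left ((Submodule.columnMatrix Z).map (Int.cast : ℤ → ℚ))
      ((boundaryMatrix Z).map (Int.cast : ℤ → ℚ))
    have h2 := rank_le_card_width ((Submodule.columnMatrix Z).map (Int.cast : ℤ → ℚ))
    rw [← hmul, rank_eq_finrank_span_cols] at h1
    rw [Fintype.card_fin] at h2
    exact h1.trans h2
  · rw [det_mul_transpose_eq_sum_minors] at hA
    obtain ⟨⟨I, hI⟩, _, hne⟩ := Finset.exists_ne_zero_of_sum_ne_zero hA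
    have hli := (linearIndepOn_ratColumn_iff I).2
      ((linearIndepOn_boundaryColumn_iff Z I hI).2 (left_ne_zero_of_mul hne))
    have hcard := finrank_span_eq_card hli
    have hle := Submodule.finrank_mono (Submodule.span_mono (R := ℚ)
      (Set.range_comp_subset_range (fun x : (I : Set (X.cells i)) => x.1)
        (ratColumn (X := X) (n := i))))
    simp only [Finset.coe_sort_coe, Fintype.card_coe, hI] at hcard
    exact hcard.symm.trans_le hle

theorem isSpanningTree_iff {r : ℕ} (Z : Module.Basis (Fin r) ℤ (X.cycles (i - 1)))
    (hA : (boundaryMatrix Z * (boundaryMatrix Z)ᵀ).det ≠ 0) (I : Finset (X.cells i)) :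
    IsSpanningTree I ↔
      ∃ hI : I.card = r, ((boundaryMatrix Z).submatrix id (I.orderEmbOfFin hI)).det ≠ 0 := by
  have hfin := finrank_span_ratColumn Z hA
  have hcard : LinearIndepOn ℚ (ratColumn (X := X) (n := i)) (I : Set (X.cells i)) →
      Module.finrank ℚ (Submodule.span ℚ
        (ratColumn (X := X) (n := i) '' (I : Set (X.cells i)))) = I.card := by
    intro h
    rw [Set.image_eq_range, finrank_span_eq_card h]
    simp
  constructor
  · rintro ⟨hli, hspan⟩
    have hI : I.card = r := by rw [← hcard hli, hspan, hfin]
    exact ⟨hI, (linearIndepOn_boundaryColumn_iff Z I hI).1 ((linearIndepOn_ratColumn_iff I).1 hli)⟩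
  · rintro ⟨hI, hdet⟩
    have hli := (linearIndepOn_ratColumn_iff I).2
      ((linearIndepOn_boundaryColumn_iff Z I hI).2 hdet)
    refine ⟨hli, Submodule.eq_of_le_of_finrank_eq
      (Submodule.span_mono (Set.image_subset_range _ _)) ?_⟩
    rw [hcard hli, hI, hfin]

/-- The matrix-tree theorem: the `i`-tree number is the Gram determinant of the rows of `[∂ᵢ]_Z`. -/
theorem treeNumber_eq_det {r : ℕ} (Z : Module.Basis (Fin r) ℤ (X.cycles (i - 1)))
    (hA : (boundaryMatrix Z * (boundaryMatrix Z)ᵀ).det ≠ 0) :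
    (X.treeNumber i : ℤ) = (boundaryMatrix Z * (boundaryMatrix Z)ᵀ).det := by
  classical
  rw [det_mul_transpose_eq_sum_minors, treeNumber, Finset.sum_filter, Nat.cast_sum]
  rw [← Finset.sum_filter_of_ne (p := fun I : Finset (X.cells i) => I.card = r),
    Finset.sum_subtype (p := fun I : Finset (X.cells i) => I.card = r) _ (by simp)]
  · refine Finset.sum_congr rfl fun I _ => ?_
    by_cases hdet : ((boundaryMatrix Z).submatrix id (I.1.orderEmbOfFin I.2)).det = 0
    · rw [if_neg, hdet]
      · simp
      · rw [isSpanningTree_iff Z hA]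
        rintro ⟨_, h⟩
        exact h hdet
    · rw [if_pos ((isSpanningTree_iff Z hA _).2 ⟨I.2, hdet⟩),
        card_redHomology_eq_natAbs_det Z I.1 I.2 hdet, Nat.cast_pow, Int.natCast_natAbs, sq_abs, sq]
  · intro I _ hI
    by_contra hne
    apply hI
    rw [if_neg, Nat.cast_zero]
    rw [isSpanningTree_iff Z hA]
    rintro ⟨h, _⟩
    exact hne h

end TreeNumber

/-! ### The dual tree number as a Gram determinant of boundaries. -/

section DualTreeNumber

/-- Since $\operatorname{rk}B_{i+1}=\operatorname{rk}Z_{i+1}$, one has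
$\operatorname{rk}Z^{i+1}=|X_{i+1}|-\operatorname{rk}\partial_{i+2}=|X_{i+1}|-\operatorname{rk}Z_{i+1}=\operatorname{rk}\partial_{i+1}=\operatorname{rk}B_i$.
-/
theorem card_basis_cocycles_eq (h_succ : Module.finrank ℤ (X.RedHomology (i + 1)) = 0) {m k : ℕ}
    (B : Module.Basis (Fin m) ℤ (X.boundaries i))
    (D : Module.Basis (Fin k) ℤ (X.cocycles (i + 1))) : k = m := by
  have h1 := finrank_redHomology_add (X := X) (i + 1)
  have h2 := (X.bd (i + 1) (i + 1 + 1)).transpose.rank_add_finrank_ker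
  have h3 := (X.bd (i + 1 - 1) (i + 1)).rank_add_finrank_ker
  have hB := Module.finrank_eq_card_basis B
  have hD := Module.finrank_eq_card_basis D
  have h4 : (X.bd (i + 1 - 1) (i + 1)).rank = (X.bd i (i + 1)).rank := by
    rw [add_sub_cancel_right]
  rw [rank_transpose_int] at h2
  rw [h4] at h3
  rw [h_succ, zero_add] at h1
  rw [Fintype.card_fin] at hB hD
  change (X.bd i (i + 1)).rank = m at hB
  change (X.bd (i + 1) (i + 1 + 1)).rank = _ at h1
  rw [cocycles] at hD
  rw [cycles] at h1
  omega

/-- The dual tree number is the Gram determinant of a basis of `Bᵢ(X)`. -/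
theorem dualTreeNumber_eq_det (h_succ : Module.finrank ℤ (X.RedHomology (i + 1)) = 0) {m k : ℕ}
    (B : Module.Basis (Fin m) ℤ (X.boundaries i))
    (D : Module.Basis (Fin k) ℤ (X.cocycles (i + 1))) :
    dualTreeNumber D = ((Submodule.columnMatrix B)ᵀ * Submodule.columnMatrix B).det := by
  classical
  obtain rfl : k = m := card_basis_cocycles_eq h_succ B D
  set E := coboundaryMatrix D with hE
  have hbd : X.bd i (i + 1) = Eᵀ * (Submodule.columnMatrix D)ᵀ := by
    rw [← transpose_mul]
    exact congrArg transpose (Submodule.columnMatrix_eq_mul_toMatrix D coboundaryColumn)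
  -- A retraction onto $Z^{i+1}$ gives a left inverse of the matrix of `D`, so the columns of `Eᵀ`
  -- are themselves boundaries. As they also generate $B_i$, they form a basis of it, and the change
  -- of basis `Q` to `B` is unimodular.
  obtain ⟨p, hp⟩ := LinearMap.exists_retraction_ker (X.bd (i + 1) (i + 1 + 1)).transpose.mulVecLin
  let φ : (X.cells (i + 1) → ℤ) →ₗ[ℤ] (Fin k → ℤ) := D.equivFun.toLinearMap ∘ₗ p
  have hφ : LinearMap.toMatrix' φ * Submodule.columnMatrix D = 1 := by
    ext a b
    have h : φ (D b) = Pi.single b 1 := by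
      have : p (D b) = D b := hp (D b)
      change D.equivFun (p (D b)) = _
      rw [this]
      ext c
      rw [D.equivFun_self, Pi.single_apply]
      simp only [eq_comm]
    have h' := congrFun (LinearMap.toMatrix'_mulVec φ (D b)) a
    rw [h, Pi.single_apply] at h'
    rw [one_apply]
    exact h'
  have hET : Eᵀ = X.bd i (i + 1) * (LinearMap.toMatrix' φ)ᵀ := by
    rw [hbd, Matrix.mul_assoc, ← transpose_mul, hφ, transpose_one, Matrix.mul_one]
  let row : Fin k → X.boundaries i := fun a => ⟨E a, LinearMap.toMatrix' φ a, by
    ext x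
    exact (congrFun (congrFun hET x) a).symm⟩
  have hEB : Eᵀ = Submodule.columnMatrix B * B.toMatrix row :=
    Submodule.columnMatrix_eq_mul_toMatrix B row
  choose c hc using fun b => (B b).2
  have hBE : Submodule.columnMatrix B = Eᵀ * ((Submodule.columnMatrix D)ᵀ * (Matrix.of c)ᵀ) := by
    rw [← Matrix.mul_assoc, ← hbd]
    ext x b
    exact (congrFun (hc b) x).symm
  set Q := B.toMatrix row
  set R := (Submodule.columnMatrix D)ᵀ * (Matrix.of c)ᵀ
  have hQR : Q * R = 1 := by
    apply mul_left_cancel_of_mulVec_injective (Submodule.columnMatrix_mulVec_injective B)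
    rw [← Matrix.mul_assoc, ← hEB, ← hBE, Matrix.mul_one]
  have hQ : Q.det * Q.det = 1 := by
    have h := congrArg det hQR
    rw [det_mul, det_one] at h
    rcases Int.eq_one_or_neg_one_of_mul_eq_one h with h | h <;> rw [h] <;> rfl
  have hEE : E * Eᵀ = Qᵀ * ((Submodule.columnMatrix B)ᵀ * Submodule.columnMatrix B) * Q := by
    have : E = Qᵀ * (Submodule.columnMatrix B)ᵀ := by
      rw [← transpose_mul, ← hEB, transpose_transpose]
    rw [hEB, this]
    simp only [Matrix.mul_assoc]
  rw [dualTreeNumber, ← hE, hEE, det_mul, det_mul, det_transpose]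
  linear_combination ((Submodule.columnMatrix B)ᵀ * Submodule.columnMatrix B).det * hQ

end DualTreeNumber

/-! ### Winding numbers. -/

section Winding

variable {m : ℕ} (W : Module.Basis (Fin (m + 1)) ℤ (X.cycles i))
  (B : Module.Basis (Fin m) ℤ (X.boundaries i))

/-- The winding number as a linear functional on `Zᵢ(X)`. -/
noncomputable def windingFunctional : X.cycles i →ₗ[ℤ] ℤ :=
  W.det.toMultilinearMap.toLinearMap
    (Fin.cons 0 fun j => Submodule.inclusion boundaries_le_cycles (B j)) 0

theorem windingFunctional_apply (z : X.cycles i) :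
    windingFunctional W B z = windingNumber W B z := by
  simp [windingFunctional, windingNumber, Module.Basis.det_apply]

theorem windingNumber_boundary (j : Fin m) :
    windingNumber W B (Submodule.inclusion boundaries_le_cycles (B j)) = 0 :=
  det_zero_of_column_eq (Fin.succ_ne_zero j).symm fun _ => rfl

/-- As $\operatorname{rk}Z_i=m+1>m$, the basis of $B_i$ extends by one independent cycle. This is
what makes $\lambda$ nonzero. -/
theorem exists_windingNumber_ne_zero : ∃ z, windingNumber W B z ≠ 0 := by
  have hli : LinearIndependent ℤ fun j => Submodule.inclusion boundaries_le_cycles (B j) :=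
    B.linearIndependent.map' _ (Submodule.ker_inclusion _ _ _)
  have hlt : m < Module.finrank ℤ (X.cycles i) := by
    rw [Module.finrank_eq_card_basis W, Fintype.card_fin]
    exact Nat.lt_succ_self m
  obtain ⟨z, hz⟩ := exists_linearIndependent_cons_of_lt_finrank hli hlt
  exact ⟨z, W.det_toMatrix_ne_zero_of_linearIndependent hz⟩

/-- The Gram determinant of a cycle orthogonal to `Bᵢ(X)` together with a basis of `Bᵢ(X)`, computed
in two ways. -/
theorem windingNumber_sq_mul_det (z : X.cycles i)
    (hz : ∀ j, (z : X.cells i → ℤ) ⬝ᵥ (B j : X.cells i → ℤ) = 0) :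
    windingNumber W B z ^ 2 * ((Submodule.columnMatrix W)ᵀ * Submodule.columnMatrix W).det =
      ((z : X.cells i → ℤ) ⬝ᵥ (z : X.cells i → ℤ)) *
        ((Submodule.columnMatrix B)ᵀ * Submodule.columnMatrix B).det := by
  set v : Fin (m + 1) → X.cycles i :=
    Fin.cons z fun j => Submodule.inclusion boundaries_le_cycles (B j) with hv
  have h1 : ((Submodule.columnMatrix v)ᵀ * Submodule.columnMatrix v).det =
      windingNumber W B z ^ 2 *
        ((Submodule.columnMatrix W)ᵀ * Submodule.columnMatrix W).det := by
    rw [Submodule.columnMatrix_eq_mul_toMatrix W v, transpose_mul, Matrix.mul_assoc,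
      ← Matrix.mul_assoc (Submodule.columnMatrix W)ᵀ, det_mul, det_mul, det_transpose,
      windingNumber]
    ring
  -- By orthogonality the first column of the Gram matrix is zero below its corner `z ⬝ᵥ z`; the
  -- remaining block is the Gram matrix of `B`.
  rw [← h1, det_of_column_zero]
  · rfl
  · intro j
    exact (dotProduct_comm _ _).trans (hz j)

end Winding

/-! ### Pairing the standard harmonic cycle with cycles. -/

section HarmonicCycle

variable [LinearOrder (X.cells i)]
  (Z : Module.Basis (Fin (X.cycleRank (i - 1))) ℤ (X.cycles (i - 1)))

/-- Laplace expansion along the added row `u`. The minus sign comes from counting columns from `1`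
in $(-1)^j$, and cancels in products of two such pairings. -/
theorem Cycletree.dotProduct_chain (U : X.Cycletree i) (u : X.cells i → ℤ) :
    u ⬝ᵥ U.chain Z =
      -((Matrix.of (Fin.cons u (boundaryMatrix Z) :
        Fin (X.cycleRank (i - 1) + 1) → X.cells i → ℤ)).submatrix id U.enum).det := by
  rw [det_succ_row_zero, Cycletree.chain, dotProduct_sum, ← Finset.sum_neg_distrib]
  refine Finset.sum_congr rfl fun j _ => ?_
  rw [dotProduct_single]
  have h : ((Matrix.of (Fin.cons u (boundaryMatrix Z) :
      Fin (X.cycleRank (i - 1) + 1) → X.cells i → ℤ)).submatrix id U.enum).submatrix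
        Fin.succ j.succAbove = (U.matrix Z).submatrix id j.succAbove := rfl
  rw [h, minorVector]
  change u (U.enum j) * _ = -((-1) ^ (j : ℕ) * u (U.enum j) * _)
  ring

/-- Cauchy–Binet for $[\partial_i]_Z$ bordered on top by `u` and by `z`: since $[\partial_i]_Z z=0$,
the product matrix has first column zero below the corner `u ⬝ᵥ z`. -/
theorem sum_dotProduct_chain_mul (u : X.cells i → ℤ) {z : X.cells i → ℤ} (hz : z ∈ X.cycles i) :
    ∑ U : X.Cycletree i, (u ⬝ᵥ U.chain Z) * (z ⬝ᵥ U.chain Z) =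
      (boundaryMatrix Z * (boundaryMatrix Z)ᵀ).det * (u ⬝ᵥ z) := by
  simp only [Cycletree.dotProduct_chain, neg_mul_neg]
  rw [mem_cycles_iff Z] at hz
  refine (det_mul_transpose_eq_sum_minors _ _).symm.trans ?_
  rw [det_of_column_zero]
  · rw [mul_comm]
    rfl
  · intro r
    exact congrFun hz r

/-- The cycle parts behave as a tight frame of $Z_i$; each coordinate is the preceding identity with
`u` a standard basis vector. -/
theorem sum_dotProduct_chain_smul_cycle (z : X.cycles i) :
    ∑ U : X.Cycletree i, ((z : X.cells i → ℤ) ⬝ᵥ U.chain Z) • U.cycle Z =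
      (boundaryMatrix Z * (boundaryMatrix Z)ᵀ).det • z := by
  ext x
  have h := sum_dotProduct_chain_mul Z (Pi.single x 1) z.2
  simp only [single_dotProduct, one_mul] at h
  simpa [Cycletree.cycle, mul_comm] using h

theorem standardHarmonicCycle_dotProduct {m : ℕ}
    (W : Module.Basis (Fin (m + 1)) ℤ (X.cycles i)) (B : Module.Basis (Fin m) ℤ (X.boundaries i))
    (z : X.cycles i) :
    (standardHarmonicCycle Z W B : X.cells i → ℤ) ⬝ᵥ (z : X.cells i → ℤ) =
      (boundaryMatrix Z * (boundaryMatrix Z)ᵀ).det * windingNumber W B z := by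
  have h := congrArg (windingFunctional W B) (sum_dotProduct_chain_smul_cycle Z z)
  simp only [map_sum, map_smul, windingFunctional_apply, smul_eq_mul] at h
  rw [← h, standardHarmonicCycle, Submodule.coe_sum, sum_dotProduct]
  refine Finset.sum_congr rfl fun U _ => ?_
  rw [Submodule.coe_smul, smul_dotProduct, smul_eq_mul, mul_comm, dotProduct_comm]
  rfl

end HarmonicCycle

end CellComplex

theorem mainTheorem5 (X : CellComplex.{u}) (i : ℤ) (hi : 0 ≤ i)
    (h_succ : Module.finrank ℤ (X.RedHomology (i + 1)) = 0)
    (h_self : Module.finrank ℤ (X.RedHomology i) = 1)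
    (h_pred : Module.finrank ℤ (X.RedHomology (i - 1)) = 0)
    [LinearOrder (X.cells i)]
    (Z : Module.Basis (Fin (X.cycleRank (i - 1))) ℤ (X.cycles (i - 1)))
    {m : ℕ} (W : Module.Basis (Fin (m + 1)) ℤ (X.cycles i))
    (B : Module.Basis (Fin m) ℤ (X.boundaries i))
    {k : ℕ} (D : Module.Basis (Fin k) ℤ (X.cocycles (i + 1))) :
    (CellComplex.standardHarmonicCycle Z W B : X.cells i → ℤ) ⬝ᵥ
        (CellComplex.standardHarmonicCycle Z W B : X.cells i → ℤ) =
      CellComplex.dualTreeNumber D * (X.treeNumber i : ℤ) *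
        (Nat.card (X.RedHomology (i - 1)) : ℤ) ^ 2 := by
  obtain ⟨hdet, hcard⟩ := CellComplex.det_boundaryMatrix_mul_transpose h_pred Z W
  have hG := det_transpose_mul_self_ne_zero _ (Submodule.columnMatrix_mulVec_injective W)
  have hA : (CellComplex.boundaryMatrix Z * (CellComplex.boundaryMatrix Z)ᵀ).det ≠ 0 := by
    rw [hdet]
    exact mul_ne_zero (pow_ne_zero 2 (Nat.cast_ne_zero.2 hcard)) hG
  rw [CellComplex.treeNumber_eq_det Z hA, CellComplex.dualTreeNumber_eq_det h_succ B D]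
  have hdot := CellComplex.standardHarmonicCycle_dotProduct Z W B
  have hself := hdot (CellComplex.standardHarmonicCycle Z W B)
  have hgram := CellComplex.windingNumber_sq_mul_det W B
    (CellComplex.standardHarmonicCycle Z W B) fun j => by
      have h := hdot (Submodule.inclusion CellComplex.boundaries_le_cycles (B j))
      rw [CellComplex.windingNumber_boundary, mul_zero] at h
      exact h
  have hne : (CellComplex.standardHarmonicCycle Z W B : X.cells i → ℤ) ⬝ᵥ
      (CellComplex.standardHarmonicCycle Z W B : X.cells i → ℤ) ≠ 0 := by
    obtain ⟨z, hz⟩ := CellComplex.exists_windingNumber_ne_zero W B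
    intro h
    rw [dotProduct_self_eq_zero] at h
    have h' := hdot z
    rw [h, zero_dotProduct] at h'
    exact mul_ne_zero hA hz h'.symm
  -- With $L=\lambda\circ\lambda$, the relations $L=aw$, $w^2G=Ld$ and $a=c^2G$ give
  -- $L^2G=a^2Ld=dac^2LG$; cancelling $LG\neq0$ leaves the claim.
  apply mul_right_cancel₀ (mul_ne_zero hne hG)
  generalize (CellComplex.standardHarmonicCycle Z W B : X.cells i → ℤ) ⬝ᵥ
      (CellComplex.standardHarmonicCycle Z W B : X.cells i → ℤ) = L at *
  generalize (CellComplex.boundaryMatrix Z * (CellComplex.boundaryMatrix Z)ᵀ).det = a at *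
  generalize ((Submodule.columnMatrix W)ᵀ * Submodule.columnMatrix W).det = G at *
  generalize ((Submodule.columnMatrix B)ᵀ * Submodule.columnMatrix B).det = d at *
  generalize CellComplex.windingNumber W B (CellComplex.standardHarmonicCycle Z W B) = w at *
  generalize (Nat.card (X.RedHomology (i - 1)) : ℤ) = c at *
  linear_combination (G * (L + a * w)) * hself + a ^ 2 * hgram + a * d * L * hdet
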